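/- Consider the linear descriptor system $$E x_{k+1}=Ax_k+Bv_k,\qquad y_k=Cx_k+Dv_k,\qquad k\in\mathbb N=\{0,1,2,\dots\},\tag{1}$$ with real matrices, $E,A\in\mathbb R^{n_x\times n_x}$, $v_k\in\mathbb R^{n_v}$, $y_k\in\mathbb R^{n_y}$. Assume that (1) is regular ($\det(\lambda E-A)\neq0$ for some $\lambda\in\mathbb C$) and R-controllable ($\operatorname{rk}[\lambda E-A\;\;B]=n_x$ for all $\lambda\in\mathbb C$). By regularity there are invertible real $S,P$ with $$S(\lambda E-A)P=\lambda\begin{bmatrix}I_{n_J}&\\&N\end{bmatrix}-\begin{bmatrix}J&\\&I_{n_N}\end{bmatrix},\qquad SB=\begin{bmatrix}B_J\\B_N\end{bmatrix},$$ $N$ nilpotent. Let $n_J$ be the dimension of the dynamic part and $\delta$ the structured nilpotency index, i.e. $\delta=\min\{i\in\mathbb N: N^iB_N=0\}$ if $n_N>0$ and $B_N\ne0$, and $\delta=1$ otherwise. Trajectories. A *realization trajectory* is a pair of sequences $(v,y)$, $v_k\in\mathbb R^{n_v}$, $y_k\in\mathbb R^{n_y}$, $k\in\mathbb N$, for which some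 $x_k\in\mathbb R^{n_x}$ satisfy (1). Let $(\Omega,\mathcal F,\mathbb P)$ be a probability space and let $(\phi^i)_{i\in I}$ be an orthonormal (Hilbert) basis of $L^2(\Omega,\mathbb R)$ (e.g. $I=\mathbb N$); a random vector $Z\in L^2(\Omega,\mathbb R^n)$ has the expansion (PCE) coefficients $\mathsf z^i=\mathbb E[Z\phi^i]\in\mathbb R^n$. Random variables $(\tilde V_k,\tilde Y_k)_{k=0}^{L-1}$ form a *random-variable trajectory* of (1) if they are the restriction to $[0,L-1]$ of sequences $V_k\in L^2(\Omega,\mathbb R^{n_v})$, $Y_k\in L^2(\Omega,\mathbb R^{n_y})$, $k\in\mathbb N$, for which there are $X_k\in L^2(\Omega,\mathbb R^{n_x})$ with $EX_{k+1}=AX_k+BV_k$ and $Y_k=CX_k+DV_k$ almost surely for all $k\in\mathbb N$. Families $(\tilde{\mathsf v}_k^i,\tilde{\mathsf y}_k^i)_{0\le k\le L-1,\,i\in I}$ form an *expansion coefficient trajectory* of (1) if they are the restriction to $[0,L-1]$ of sequences $\mathsf v_k\in\ell^2(I;\mathbb R^{n_v})$, $\mathsf y_k\in\ell^2(I;\mathbb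 R^{n_y})$, $k\in\mathbb N$, for which there are $\mathsf x_k\in\ell^2(I;\mathbb R^{n_x})$ with $E\mathsf x^i_{k+1}=A\mathsf x^i_k+B\mathsf v^i_k$ and $\mathsf y^i_k=C\mathsf x^i_k+D\mathsf v^i_k$ for all $k\in\mathbb N$, $i\in I$. For a sequence $f$ let $\mathcal H_L(f_{[0,M]})$ be the block Hankel matrix with the $M-L+2$ columns $(f_j^\top,\dots,f_{j+L-1}^\top)^\top$, $j=0,\dots,M-L+1$; the samples $f_{[0,M]}$ are *persistently exciting of order $K$* if $\mathcal H_K(f_{[0,M]})$ has full row rank. **Lemma (stochastic descriptor fundamental lemma).** Let $(v,y)$ be a realization trajectory of (1) such that $v_{[0,T-1]}$ is persistently exciting of order $L+n_J+\delta-1$, and put $$H=\begin{bmatrix}\mathcal H_L(v_{[0,T-\delta]})\\ \mathcal H_L(y_{[0,T-\delta]})\end{bmatrix}.$$ Let $\tilde V_k\in L^2(\Omega,\mathbb R^{n_v})$, $\tilde Y_k\in L^2(\Omega,\mathbb R^{n_y})$, $0\le k\le L-1$, have expansion coefficients $\tilde{\mathsf v}_k^i,\tilde{\mathsf y}_k^i$.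 Then: 1. $(\tilde{\mathsf v},\tilde{\mathsf y})$ is an expansion coefficient trajectory of (1) on $[0,L-1]$ if and only if there is $\mathsf g\in\ell^2(I;\mathbb R^{T-L-\delta+2})$ with $\begin{bmatrix}\tilde{\mathsf v}^i_{[0,L-1]}\\ \tilde{\mathsf y}^i_{[0,L-1]}\end{bmatrix}=H\,\mathsf g^i$ for all $i\in I$. 2. $(\tilde V,\tilde Y)$ is a random-variable trajectory of (1) on $[0,L-1]$ if and only if there is $G\in L^2(\Omega,\mathbb R^{T-L-\delta+2})$ with $\begin{bmatrix}\tilde V_{[0,L-1]}\\ \tilde Y_{[0,L-1]}\end{bmatrix}=H\,G$ almost surely. -/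

import Mathlib

open MeasureTheory Matrix
open scoped ENNReal

/-- Euclidean space `ℝⁿ`. -/
abbrev Vec (n : ℕ) : Type := EuclideanSpace ℝ (Fin n)

/-- The matrices of the linear descriptor system
`E x_{k+1} = A x_k + B v_k`, `y_k = C x_k + D v_k`. -/
structure DescriptorSystem (nx nv ny : ℕ) where
  E : Matrix (Fin nx) (Fin nx) ℝ
  A : Matrix (Fin nx) (Fin nx) ℝ
  B : Matrix (Fin nx) (Fin nv) ℝ
  C : Matrix (Fin ny) (Fin nx) ℝ
  D : Matrix (Fin ny) (Fin nv) ℝ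

/-- The pencil `λ E - A`, for complex `λ`. -/
def pencil {nx : ℕ} (E A : Matrix (Fin nx) (Fin nx) ℝ) (z : ℂ) :
    Matrix (Fin nx) (Fin nx) ℂ :=
  z • E.map Complex.ofReal - A.map Complex.ofReal

/-- A quasi-Weierstraß form
`S (λ E - A) P = λ diag(I, N) - diag(J, I)` of the pencil, with `S`, `P` invertible, `N` nilpotent,
and diagonal blocks of sizes `nJ` and `nN`. (The two coefficients of `λ` are listed separately.) -/
structure QuasiWeierstrassForm {nx : ℕ} (E A : Matrix (Fin nx) (Fin nx) ℝ) (nJ nN : ℕ) where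
  S : Matrix (Fin nJ ⊕ Fin nN) (Fin nx) ℝ
  P : Matrix (Fin nx) (Fin nJ ⊕ Fin nN) ℝ
  Sinv : Matrix (Fin nx) (Fin nJ ⊕ Fin nN) ℝ
  Pinv : Matrix (Fin nJ ⊕ Fin nN) (Fin nx) ℝ
  J : Matrix (Fin nJ) (Fin nJ) ℝ
  N : Matrix (Fin nN) (Fin nN) ℝ
  S_mul_Sinv : S * Sinv = 1
  Sinv_mul_S : Sinv * S = 1
  P_mul_Pinv : P * Pinv = 1
  Pinv_mul_P : Pinv * P = 1
  isNilpotent_N : IsNilpotent N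
  transform_E : S * E * P = fromBlocks 1 0 0 N
  transform_A : S * A * P = fromBlocks J 0 0 1

namespace QuasiWeierstrassForm

variable {nx nJ nN nv : ℕ} {E A : Matrix (Fin nx) (Fin nx) ℝ}

/-- The algebraic block `B_N` of `S B`. -/
def algInput (W : QuasiWeierstrassForm E A nJ nN) (B : Matrix (Fin nx) (Fin nv) ℝ) :
    Matrix (Fin nN) (Fin nv) ℝ :=
  (W.S * B).toRows₂

open Classical in
/-- The structured nilpotency index: `min {i | N ^ i * B_N = 0}` if `nN > 0` and `B_N ≠ 0`,
and `1` otherwise. -/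
noncomputable def structuredIndex (W : QuasiWeierstrassForm E A nJ nN)
    (B : Matrix (Fin nx) (Fin nv) ℝ) : ℕ :=
  if 0 < nN ∧ W.algInput B ≠ 0 then sInf {i : ℕ | W.N ^ i * W.algInput B = 0} else 1

end QuasiWeierstrassForm

namespace DescriptorSystem

variable {nx nv ny : ℕ}

/-- Regularity: `det (λ E - A) ≠ 0` for some complex `λ`. -/
def IsRegular (S : DescriptorSystem nx nv ny) : Prop :=
  ∃ z : ℂ, (pencil S.E S.A z).det ≠ 0

/-- R-controllability: `rk [λ E - A, B] = nx` for all complex `λ`. -/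
def IsRControllable (S : DescriptorSystem nx nv ny) : Prop :=
  ∀ z : ℂ, (fromCols (pencil S.E S.A z) (S.B.map Complex.ofReal)).rank = nx

/-- The system has a dynamic part of dimension `nJ` and structured nilpotency index `δ`, as read off
from a quasi-Weierstraß form. -/
def HasIndices (S : DescriptorSystem nx nv ny) (nJ δ : ℕ) : Prop :=
  ∃ (nN : ℕ) (W : QuasiWeierstrassForm S.E S.A nJ nN), W.structuredIndex S.B = δ

/-- The system equations at one time instant, for the current state `x`, next state `x'`,
input `v` and output `y`. -/
def Satisfies (S : DescriptorSystem nx nv ny) (x x' : Vec nx) (v : Vec nv) (y : Vec ny) : Prop :=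
  S.E *ᵥ x'.ofLp = S.A *ᵥ x.ofLp + S.B *ᵥ v.ofLp ∧
    y.ofLp = S.C *ᵥ x.ofLp + S.D *ᵥ v.ofLp

/-- The (infinite-horizon, manifest) realization behavior: deterministic input-output trajectories
for which there is a state trajectory. -/
def IsRealizationTrajectory (S : DescriptorSystem nx nv ny) (v : ℕ → Vec nv) (y : ℕ → Vec ny) :
    Prop :=
  ∃ x : ℕ → Vec nx, ∀ k, S.Satisfies (x k) (x (k + 1)) (v k) (y k)

/-- `(v, y)` is an input-output trajectory on `[0, L - 1]` of the system in expansion coefficients: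
it is the restriction of an infinite-horizon trajectory with values in `ℓ²`, whose `i`-th
coefficients obey the system equations for every `i`. -/
def IsCoefficientTrajectory {ι : Type*} (S : DescriptorSystem nx nv ny) {L : ℕ}
    (v : Fin L → ι → Vec nv) (y : Fin L → ι → Vec ny) : Prop :=
  ∃ (x' : ℕ → lp (fun _ : ι => Vec nx) 2) (v' : ℕ → lp (fun _ : ι => Vec nv) 2)
    (y' : ℕ → lp (fun _ : ι => Vec ny) 2),
    (∀ k i, S.Satisfies (x' k i) (x' (k + 1) i) (v' k i) (y' k i)) ∧
    ∀ (k : Fin L) (i : ι), v' k i = v k i ∧ y' k i = y k i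

/-- `(V, Y)` is an input-output trajectory on `[0, L - 1]` of the system in random variables:
it is the restriction of an infinite-horizon trajectory with values in `L²(Ω)`, which obeys the
system equations almost surely. -/
def IsRandomTrajectory {Ω : Type*} [MeasurableSpace Ω] {μ : Measure Ω}
    (S : DescriptorSystem nx nv ny) {L : ℕ}
    (V : Fin L → Lp (Vec nv) 2 μ) (Y : Fin L → Lp (Vec ny) 2 μ) : Prop :=
  ∃ (X' : ℕ → Lp (Vec nx) 2 μ) (V' : ℕ → Lp (Vec nv) 2 μ) (Y' : ℕ → Lp (Vec ny) 2 μ),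
    (∀ k, ∀ᵐ ω ∂μ, S.Satisfies (X' k ω) (X' (k + 1) ω) (V' k ω) (Y' k ω)) ∧
    ∀ k : Fin L, V' k = V k ∧ Y' k = Y k

end DescriptorSystem

/-- The Hankel matrix with `L` block rows and `q` columns whose `j`-th column is
`(f_j, …, f_{j + L - 1})`; this is `H_L(f_{[0, L + q - 2]})`. -/
def hankel {n : ℕ} (L q : ℕ) (f : ℕ → Vec n) : Matrix (Fin L × Fin n) (Fin q) ℝ :=
  Matrix.of fun p j => f (p.1 + j) p.2

/-- The samples `f_0, …, f_{T - 1}` are persistently exciting of order `K`: the Hankel matrix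
`H_K(f_{[0, T - 1]})`, which has `T - K + 1` columns (none if `T < K`), has full row rank. -/
def IsPersistentlyExciting {n : ℕ} (T K : ℕ) (f : ℕ → Vec n) : Prop :=
  (hankel K (T + 1 - K) f).rank = K * n

/-- The stacked column `(f_0, …, f_{L-1}, h_0, …, h_{L-1})`. -/
def stack {L n m : ℕ} (f : Fin L → Vec n) (h : Fin L → Vec m) :
    (Fin L × Fin n) ⊕ (Fin L × Fin m) → ℝ :=
  Sum.elim (fun p => f p.1 p.2) (fun p => h p.1 p.2)

/-- The expansion (PCE) coefficient `∫ Z φ^i dμ ∈ ℝⁿ` of the random vector `Z` with respect to the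
orthonormal basis `φ` of `L²(Ω; ℝ)`. -/
noncomputable def pceCoeff {Ω : Type*} [MeasurableSpace Ω] {μ : Measure Ω} {ι : Type*} {n : ℕ}
    (φ : HilbertBasis ι ℝ (Lp ℝ 2 μ)) (Z : Lp (Vec n) 2 μ) (i : ι) : Vec n :=
  WithLp.toLp 2 fun j => ∫ ω, Z ω j * φ i ω ∂μ

/-- A regular real pencil is invertible at some real point. -/
theorem DescriptorSystem.IsRegular.exists_real {nx nv ny : ℕ} {S : DescriptorSystem nx nv ny}
    (h : S.IsRegular) : ∃ s : ℝ, IsUnit (s • S.E - S.A).det := by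
  obtain ⟨z, hz⟩ := h
  let M : Matrix (Fin nx) (Fin nx) (Polynomial ℝ) :=
    (Polynomial.X : Polynomial ℝ) • S.E.map Polynomial.C - S.A.map Polynomial.C
  have h1 : Polynomial.aeval z M.det = (pencil S.E S.A z).det := by
    rw [AlgHom.map_det]
    congr 1
    ext i j
    simp [M, pencil]; ring
  have h2 : M.det ≠ 0 := by
    intro h0
    rw [h0, map_zero] at h1
    exact hz h1.symm
  obtain ⟨s, hs⟩ : ∃ s : ℝ, M.det.eval s ≠ 0 := by
    by_contra! hcon
    exact h2 (Polynomial.funext (by simpa using hcon))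
  refine ⟨s, isUnit_iff_ne_zero.mpr ?_⟩
  have h3 : M.det.eval s = (s • S.E - S.A).det := by
    rw [← Polynomial.coe_evalRingHom, RingHom.map_det]
    congr 1
    ext i j
    simp [M]; ring
  rwa [← h3]

/-- Every real square matrix is similar to a block-diagonal one with an invertible and a nilpotent
block. -/
theorem exists_fitting_blocks {n : ℕ} (M : Matrix (Fin n) (Fin n) ℝ) :
    ∃ (a b : ℕ) (P : Matrix (Fin n) (Fin a ⊕ Fin b) ℝ) (Q : Matrix (Fin a ⊕ Fin b) (Fin n) ℝ)
      (M₁ : Matrix (Fin a) (Fin a) ℝ) (M₂ : Matrix (Fin b) (Fin b) ℝ),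
      P * Q = 1 ∧ Q * P = 1 ∧ IsUnit M₁ ∧ IsNilpotent M₂ ∧
        Q * M * P = fromBlocks M₁ 0 0 M₂ := by
  let f : Module.End ℝ (Fin n → ℝ) := Matrix.toLin' M
  obtain ⟨k, hk⟩ := (LinearMap.eventually_isCompl_ker_pow_range_pow f).exists_forall_of_atTop
  replace hk := hk (k + 1) (by omega)
  set m := k + 1 with hm
  set R := LinearMap.range (f ^ m) with hR
  set K := LinearMap.ker (f ^ m) with hK
  have hcomm : ∀ x, (f ^ m) (f x) = f ((f ^ m) x) := fun x => by
    rw [← Module.End.mul_apply, ← Module.End.mul_apply, ← pow_succ, ← pow_succ']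
  have hfR : ∀ x ∈ R, f x ∈ R := by
    rintro _ ⟨x, rfl⟩
    exact ⟨f x, hcomm x⟩
  have hfK : ∀ x ∈ K, f x ∈ K := by
    intro x hx
    rw [hK, LinearMap.mem_ker] at hx ⊢
    rw [hcomm, hx, map_zero]
  let f₁ : Module.End ℝ R := f.restrict hfR
  let f₂ : Module.End ℝ K := f.restrict hfK
  have hf₁ : IsUnit f₁ := by
    rw [LinearMap.isUnit_iff_ker_eq_bot, LinearMap.ker_eq_bot']
    intro x hx
    have hx0 : f x = 0 := congrArg Subtype.val hx
    have hxK : (x : Fin n → ℝ) ∈ K := by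
      rw [hK, LinearMap.mem_ker, hm, pow_succ, Module.End.mul_apply, hx0, map_zero]
    have := (Submodule.disjoint_def.mp hk.disjoint) x hxK x.2
    exact Subtype.ext this
  have hf₂ : f₂ ^ m = 0 := by
    have key : ∀ (j : ℕ) (x : K), ((f₂ ^ j) x : Fin n → ℝ) = (f ^ j) x := by
      intro j
      induction j with
      | zero => intro x; simp
      | succ j ih =>
        intro x
        rw [pow_succ', Module.End.mul_apply, pow_succ', Module.End.mul_apply, ← ih]
        rfl
    ext1 x
    apply Subtype.ext
    rw [key]
    exact x.2
  let bR := Module.finBasis ℝ R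
  let bK := Module.finBasis ℝ K
  let e := Submodule.prodEquivOfIsCompl R K hk.symm
  let b := (bR.prod bK).map e
  let c := Pi.basisFun ℝ (Fin n)
  refine ⟨_, _, LinearMap.toMatrix b c LinearMap.id, LinearMap.toMatrix c b LinearMap.id,
    LinearMap.toMatrix bR bR f₁, LinearMap.toMatrix bK bK f₂, ?_, ?_, ?_, ?_, ?_⟩
  · rw [← LinearMap.toMatrix_comp, LinearMap.id_comp, LinearMap.toMatrix_id]
  · rw [← LinearMap.toMatrix_comp, LinearMap.id_comp, LinearMap.toMatrix_id]
  · exact hf₁.map (LinearMap.toMatrixAlgEquiv bR)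
  · exact ⟨m, by
      have := map_pow (LinearMap.toMatrixAlgEquiv bK) f₂ m
      rw [hf₂, map_zero] at this
      exact this.symm⟩
  · have hM : M = LinearMap.toMatrix c c f := (LinearMap.toMatrix'_toLin' M).symm
    rw [hM, ← LinearMap.toMatrix_comp, ← LinearMap.toMatrix_comp, LinearMap.id_comp,
      LinearMap.comp_id]
    have hinl : ∀ x : R, e.symm (x : Fin n → ℝ) = (x, 0) := fun x => by
      rw [LinearEquiv.symm_apply_eq]; simp [e]
    have hinr : ∀ x : K, e.symm (x : Fin n → ℝ) = (0, x) := fun x => by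
      rw [LinearEquiv.symm_apply_eq]; simp [e]
    have hl : ∀ j, f (b (Sum.inl j)) = (f₁ (bR j) : Fin n → ℝ) := fun j => by
      simp [b, e, f₁]
    have hr : ∀ j, f (b (Sum.inr j)) = (f₂ (bK j) : Fin n → ℝ) := fun j => by
      simp [b, e, f₂]
    ext i j
    rcases j with j | j
    · rw [LinearMap.toMatrix_apply, hl]
      rcases i with i | i <;>
        simp [b, hinl, LinearMap.toMatrix_apply]
    · rw [LinearMap.toMatrix_apply, hr]
      rcases i with i | i <;>
        simp [b, hinr, LinearMap.toMatrix_apply]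

/-- A regular system has a quasi-Weierstraß form, so that its indices exist. -/
theorem DescriptorSystem.IsRegular.exists_hasIndices {nx nv ny : ℕ}
    {S : DescriptorSystem nx nv ny} (h : S.IsRegular) : ∃ nJ δ : ℕ, S.HasIndices nJ δ := by
  obtain ⟨s, hs⟩ := h.exists_real
  set G := s • S.E - S.A with hG
  have hGi : G⁻¹ * G = 1 := Matrix.nonsing_inv_mul G hs
  have hiG : G * G⁻¹ = 1 := Matrix.mul_nonsing_inv G hs
  obtain ⟨a, b, P, Q, M₁, M₂, hPQ, hQP, hM₁, hM₂, hM⟩ := exists_fitting_blocks (G⁻¹ * S.E)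
  have hU : IsUnit (s • M₂ - 1) := by
    have : IsNilpotent (s • M₂) := hM₂.smul s
    simpa using this.isUnit_sub_one
  obtain ⟨U, hU'⟩ := hU
  obtain ⟨V, hV'⟩ := hM₁
  have hA : Q * (G⁻¹ * S.A) * P = fromBlocks (s • M₁ - 1) 0 0 (s • M₂ - 1) := by
    have h1 : G⁻¹ * S.A = s • (G⁻¹ * S.E) - 1 := by
      rw [← hGi, hG, Matrix.mul_sub, Matrix.mul_smul]
      abel
    rw [h1, Matrix.mul_sub, Matrix.sub_mul, Matrix.mul_smul, Matrix.smul_mul, hM, Matrix.mul_one,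
      hQP, ← Matrix.fromBlocks_one, Matrix.fromBlocks_smul, sub_eq_add_neg,
      Matrix.fromBlocks_neg, Matrix.fromBlocks_add]
    simp [sub_eq_add_neg]
  let Z : Matrix (Fin a ⊕ Fin b) (Fin a ⊕ Fin b) ℝ := fromBlocks ↑V⁻¹ 0 0 ↑U⁻¹
  let Z' : Matrix (Fin a ⊕ Fin b) (Fin a ⊕ Fin b) ℝ := fromBlocks ↑V 0 0 ↑U
  have hZ : Z * Z' = 1 := by simp [Z, Z', Matrix.fromBlocks_multiply]
  have hZ' : Z' * Z = 1 := by simp [Z, Z', Matrix.fromBlocks_multiply]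
  let W : QuasiWeierstrassForm S.E S.A a b :=
    { S := Z * Q * G⁻¹
      P := P
      Sinv := G * P * Z'
      Pinv := Q
      J := ↑V⁻¹ * (s • M₁ - 1)
      N := ↑U⁻¹ * M₂
      S_mul_Sinv := by
        calc Z * Q * G⁻¹ * (G * P * Z') = Z * (Q * ((G⁻¹ * G) * P)) * Z' := by
              simp only [Matrix.mul_assoc]
          _ = 1 := by rw [hGi, Matrix.one_mul, hQP, Matrix.mul_one, hZ]
      Sinv_mul_S := by
        calc G * P * Z' * (Z * Q * G⁻¹) = G * (P * ((Z' * Z) * Q)) * G⁻¹ := by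
              simp only [Matrix.mul_assoc]
          _ = 1 := by rw [hZ', Matrix.one_mul, hPQ, Matrix.mul_one, hiG]
      P_mul_Pinv := hPQ
      Pinv_mul_P := hQP
      isNilpotent_N := by
        have hc : Commute (U : Matrix (Fin b) (Fin b) ℝ) M₂ := by
          rw [hU']
          exact ((Commute.refl M₂).smul_left s).sub_left (Commute.one_left M₂)
        exact hc.units_inv_left.isNilpotent_mul_left hM₂
      transform_E := by
        calc Z * Q * G⁻¹ * S.E * P = Z * (Q * (G⁻¹ * S.E) * P) := by
              simp only [Matrix.mul_assoc]
          _ = _ := by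
              rw [hM, ← hV']
              simp [Z, Matrix.fromBlocks_multiply]
      transform_A := by
        calc Z * Q * G⁻¹ * S.A * P = Z * (Q * (G⁻¹ * S.A) * P) := by
              simp only [Matrix.mul_assoc]
          _ = _ := by
              rw [hA, ← hU']
              simp [Z, Matrix.fromBlocks_multiply] }
  exact ⟨a, W.structuredIndex S.B, b, W, rfl⟩

/-! In quasi-Weierstraß coordinates the state splits into a dynamic part `z`, governed by `z (k + 1)
= J z k + B_J v k`, and an algebraic part which, `N` being nilpotent, is a combination of `v k, …, v
(k + δ - 1)`. Hence outputs on `[0, L - 1]` depend only on `z 0` and on the first `L + δ - 1`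
inputs.

R-controllability of the pencil makes `(J, B_J)` controllable (Hautus). Willems' lemma then says
that, for inputs persistently exciting of order `(L + δ - 1) + nJ`, every initial `z 0` with every
input segment of length `L + δ - 1` is a combination of the data windows. It is proved dually, in
`eq_zero_of_annihilates_data`: a functional vanishing on all windows is shifted in time, and the
shifts are combined with the coefficients of the characteristic polynomial of `J`. By
Cayley–Hamilton the state drops out, leaving a left null vector of the input Hankel matrix. This
gives the deterministic lemma `IsRealizationTrajectory.exists_shiftCombination`.

The stochastic statements follow by applying it for each `i`, or for almost every `ω`. Square
summability or integrability of the coefficients comes from choosing them by one fixed linear map, a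
generalized inverse of the data map. Conversely, combinations of shifts of the data, with their
states, are infinite-horizon trajectories. -/

/-! ### Controllability and the dual form of Willems' lemma -/

/-- Hautus test: if no left eigenvector of `J` over `ℂ` annihilates `B`, then no real row vector
annihilates all the `J ^ k * B`. -/
theorem eq_zero_of_vecMul_pow_mul_eq_zero {n m : ℕ} {J : Matrix (Fin n) (Fin n) ℝ}
    {B : Matrix (Fin n) (Fin m) ℝ}
    (h : ∀ (c : ℂ) (ξ : Fin n → ℂ), ξ ᵥ* J.map Complex.ofReal = c • ξ →
      ξ ᵥ* B.map Complex.ofReal = 0 → ξ = 0)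
    {ξ : Fin n → ℝ} (hξ : ∀ k, ξ ᵥ* (J ^ k * B) = 0) : ξ = 0 := by
  by_contra hne
  let Jc := J.map Complex.ofReal
  let Bc := B.map Complex.ofReal
  -- `U` is invariant under right multiplication by `Jc` and contains the complexified `ξ`. If `ξ`
  -- were nonzero, `U` would contain an eigenvector, which annihilates `Bc` by the case `k = 0`.
  let U : Submodule ℂ (Fin n → ℂ) := ⨅ k : ℕ, LinearMap.ker (Matrix.vecMulLinear (Jc ^ k * Bc))
  have hU : ∀ x : Fin n → ℂ, x ∈ U ↔ ∀ k, x ᵥ* (Jc ^ k * Bc) = 0 := by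
    intro x; simp [U]
  have hinv : ∀ x ∈ U, Matrix.vecMulLinear Jc x ∈ U := by
    intro x hx
    rw [hU] at hx ⊢
    intro k
    rw [Matrix.vecMulLinear_apply, Matrix.vecMul_vecMul, ← Matrix.mul_assoc, ← pow_succ']
    exact hx (k + 1)
  have hmem : (fun i => (ξ i : ℂ)) ∈ U := by
    rw [hU]
    intro k
    have h1 : Jc ^ k * Bc = (J ^ k * B).map Complex.ofRealHom := by
      rw [Matrix.map_mul]
      congr 1
      exact (Matrix.map_pow J Complex.ofRealHom k).symm
    rw [h1]
    have h2 := RingHom.map_vecMul Complex.ofRealHom (J ^ k * B) ξ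
    ext j
    have := h2 j
    rw [hξ k] at this
    simpa [Function.comp_def] using this.symm
  have hnt : Nontrivial U := by
    refine ⟨⟨⟨_, hmem⟩, 0, fun h0 => hne ?_⟩⟩
    have := congrArg Subtype.val h0
    ext i
    simpa using congrFun this i
  obtain ⟨c, hc⟩ := Module.End.exists_eigenvalue ((Matrix.vecMulLinear Jc).restrict hinv)
  obtain ⟨x, hx⟩ := hc.exists_hasEigenvector
  refine hx.2 (Subtype.ext (h c x (congrArg Subtype.val hx.apply_eq_smul) ?_))
  simpa using (hU x).1 x.2 0

/-- If the charpoly recursion `∑ c_l e (t - l)` of a sequence vanishes for nonnegative `t` and the sequence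
vanishes for large indices, it vanishes from `-n` on. -/
theorem eq_zero_of_monic_recursion {M : Type*} [AddCommGroup M] [Module ℝ M]
    (p : Polynomial ℝ) (hp : p.Monic) (e : ℤ → M) (m : ℕ)
    (he : ∀ i : ℤ, m ≤ i → e i = 0)
    (hrec : ∀ t : ℕ, t < m + p.natDegree →
      ∑ l ∈ Finset.range (p.natDegree + 1), p.coeff l • e (t - l) = 0) :
    ∀ i : ℤ, -(p.natDegree : ℤ) ≤ i → e i = 0 := by
  have key : ∀ k : ℕ, k < m + p.natDegree → e (m - 1 - k) = 0 := by
    intro k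
    induction k using Nat.strong_induction_on with
    | _ k ih =>
      intro hk
      -- At this time the leading term `l = p.natDegree`, of coefficient one, is `e (m - 1 - k)`;
      -- all other terms have larger indices, where `e` is already known to vanish.
      have h1 := hrec (m + p.natDegree - 1 - k) (by omega)
      rw [Finset.sum_range_succ, Finset.sum_eq_zero, hp.coeff_natDegree, one_smul, zero_add] at h1
      · rw [← h1]; congr 1; omega
      · intro l hl
        rw [Finset.mem_range] at hl
        suffices e ((m + p.natDegree - 1 - k : ℕ) - l) = 0 by rw [this, smul_zero]
        by_cases hkl : p.natDegree ≤ k + l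
        · have := ih (k + l - p.natDegree) (by omega) (by omega)
          rw [← this]; congr 1; omega
        · exact he _ (by omega)
  intro i hi
  by_cases him : (m : ℤ) ≤ i
  · exact he i him
  · have := key (m - 1 - i).toNat (by omega)
    rw [← this]; congr 1; omega

/-- Variation of constants: it rewrites a relation on the state at time `j + l` as one on the state
at time `j` and the inputs in between. -/
theorem state_add {n nv : ℕ} {J : Matrix (Fin n) (Fin n) ℝ} {B : Matrix (Fin n) (Fin nv) ℝ}
    {z : ℕ → Fin n → ℝ} {v : ℕ → Fin nv → ℝ} (hz : ∀ k, z (k + 1) = J *ᵥ z k + B *ᵥ v k)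
    (j l : ℕ) :
    z (j + l) = (J ^ l) *ᵥ z j + ∑ s ∈ Finset.range l, (J ^ (l - 1 - s) * B) *ᵥ v (j + s) := by
  induction l with
  | zero => simp
  | succ l ih =>
    rw [← add_assoc, hz, ih, Matrix.mulVec_add, Matrix.mulVec_mulVec, ← pow_succ', Finset.sum_range_succ,
      Matrix.mulVec_sum, add_assoc]
    congr 2
    · refine Finset.sum_congr rfl fun s hs => ?_
      rw [Finset.mem_range] at hs
      rw [Matrix.mulVec_mulVec, ← Matrix.mul_assoc, ← pow_succ']
      congr 3; omega
    · simp

/-- Willems' lemma, in dual form: a functional of the state and of the next `m` inputs that vanishes along the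
data is zero. -/
theorem eq_zero_of_annihilates_data {n nv : ℕ} {J : Matrix (Fin n) (Fin n) ℝ} {B : Matrix (Fin n) (Fin nv) ℝ}
    (hctrl : ∀ ξ : Fin n → ℝ, (∀ k, ξ ᵥ* (J ^ k * B) = 0) → ξ = 0)
    {z : ℕ → Fin n → ℝ} {v : ℕ → Fin nv → ℝ} (hz : ∀ k, z (k + 1) = J *ᵥ z k + B *ᵥ v k)
    {T m : ℕ}
    (hpe : ∀ θ : ℕ → Fin nv → ℝ,
      (∀ j < T + 1 - (m + n), ∑ t ∈ Finset.range (m + n), θ t ⬝ᵥ v (j + t) = 0) →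
      ∀ t < m + n, θ t = 0)
    (ξ : Fin n → ℝ) (η : ℕ → Fin nv → ℝ)
    (h : ∀ j < T + 1 - m, ξ ⬝ᵥ z j + ∑ i ∈ Finset.range m, η i ⬝ᵥ v (j + i) = 0) :
    ξ = 0 ∧ ∀ i < m, η i = 0 := by
  set p := J.charpoly with hp
  have hmon : p.Monic := J.charpoly_monic
  have hdeg : p.natDegree = n := by rw [hp, J.charpoly_natDegree_eq_dim, Fintype.card_fin]
  have hCH : ∑ l ∈ Finset.range (n + 1), p.coeff l • J ^ l = 0 := by
    have := Matrix.aeval_self_charpoly J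
    rwa [Polynomial.aeval_eq_sum_range, ← hp, hdeg] at this
  -- One two-sided sequence holds the input coefficients of all shifts: moving the functional by `l`
  -- and eliminating `z (j + l)` puts the weight `e (t - l)` on `v (j + t)`. Negative indices come
  -- from the elimination of the state.
  let e : ℤ → Fin nv → ℝ := fun i =>
    if i < 0 then ξ ᵥ* (J ^ (-1 - i).toNat * B) else if i < m then η i.toNat else 0
  have hshift : ∀ l ≤ n, ∀ j < T + 1 - (m + n),
      (ξ ᵥ* J ^ l) ⬝ᵥ z j + ∑ t ∈ Finset.range (m + n), e (t - l) ⬝ᵥ v (j + t) = 0 := by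
    intro l hl j hj
    rw [← h (j + l) (by omega), state_add hz, dotProduct_add, dotProduct_sum, ← dotProduct_mulVec, add_assoc]
    congr 1
    -- The `m + n` inputs are the `l` ones created by the shift, the `m` original ones, and `n - l`
    -- padding ones of weight zero.
    have hsplit : m + n = l + (m + (n - l)) := by omega
    rw [hsplit, Finset.sum_range_add, Finset.sum_range_add _ m]
    have h0 : ∑ x ∈ Finset.range (n - l), e ((l + (m + x) : ℕ) - l) ⬝ᵥ v (j + (l + (m + x))) = 0 := by
      refine Finset.sum_eq_zero fun x _ => ?_
      have : e ((l + (m + x) : ℕ) - l) = 0 := by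
        simp only [e]
        rw [if_neg (by omega), if_neg (by omega)]
      rw [this, zero_dotProduct]
    rw [h0, add_zero]
    congr 1
    · refine Finset.sum_congr rfl fun s hs => ?_
      rw [Finset.mem_range] at hs
      have : e ((s : ℤ) - l) = ξ ᵥ* (J ^ (l - 1 - s) * B) := by
        simp only [e]
        rw [if_pos (by omega)]
        congr 3; omega
      rw [this, ← dotProduct_mulVec]
    · refine Finset.sum_congr rfl fun s hs => ?_
      rw [Finset.mem_range] at hs
      have : e ((l + s : ℕ) - l) = η s := by
        simp only [e]
        rw [if_neg (by omega), if_pos (by omega)]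
        congr 1; omega
      rw [this, add_assoc]
  -- Combining the shifts with the coefficients of the characteristic polynomial cancels the state,
  -- so excitation of order `m + n` forces the combined input weights to vanish.
  have hθ := hpe (fun t => ∑ l ∈ Finset.range (n + 1), p.coeff l • e (t - l)) (by
    intro j hj
    have h1 : ∑ l ∈ Finset.range (n + 1), p.coeff l •
        ((ξ ᵥ* J ^ l) ⬝ᵥ z j + ∑ t ∈ Finset.range (m + n), e (t - l) ⬝ᵥ v (j + t)) = 0 := by
      refine Finset.sum_eq_zero fun l hl => ?_
      rw [Finset.mem_range] at hl
      rw [hshift l (by omega) j hj, smul_zero]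
    have h2 : ∑ l ∈ Finset.range (n + 1), p.coeff l • ((ξ ᵥ* J ^ l) ⬝ᵥ z j) = 0 := by
      calc _ = (ξ ᵥ* ∑ l ∈ Finset.range (n + 1), p.coeff l • J ^ l) ⬝ᵥ z j := by
            rw [Matrix.vecMul_sum, sum_dotProduct]
            refine Finset.sum_congr rfl fun l _ => ?_
            rw [Matrix.vecMul_smul, smul_dotProduct]
        _ = 0 := by rw [hCH, Matrix.vecMul_zero, zero_dotProduct]
    simp only [smul_add, Finset.sum_add_distrib, h2, zero_add, Finset.smul_sum] at h1
    rw [Finset.sum_comm] at h1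
    simpa only [sum_dotProduct, smul_dotProduct] using h1)
  have he := eq_zero_of_monic_recursion p hmon e m
    (by
      intro i hi
      simp only [e]
      rw [if_neg (by omega), if_neg (by omega)])
    (by rw [hdeg]; exact hθ)
  rw [hdeg] at he
  constructor
  · apply hctrl
    have hlow : ∀ k < n, ξ ᵥ* (J ^ k * B) = 0 := by
      intro k hk
      have := he (-1 - k) (by omega)
      simp only [e] at this
      rw [if_pos (by omega)] at this
      rwa [show (-1 - (-1 - (k : ℤ))).toNat = k by omega] at this
    intro k
    induction k using Nat.strong_induction_on with
    | _ k ih =>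
      by_cases hk : k < n
      · exact hlow k hk
      · obtain ⟨r, rfl⟩ := Nat.exists_eq_add_of_le (not_lt.1 hk)
        -- Cayley–Hamilton reduces the higher powers to those below `n`.
        have h1 : J ^ (n + r) = -∑ l ∈ Finset.range n, p.coeff l • J ^ (l + r) := by
          rw [eq_neg_iff_add_eq_zero, add_comm]
          have := congrArg (· * J ^ r) hCH
          simp only [Finset.sum_mul, Matrix.zero_mul, smul_mul_assoc, ← pow_add] at this
          rw [Finset.sum_range_succ] at this
          have hc : p.coeff n = 1 := by rw [← hdeg]; exact hmon.coeff_natDegree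
          rwa [hc, one_smul] at this
        rw [h1, Matrix.neg_mul, Matrix.sum_mul, Matrix.vecMul_neg, Matrix.vecMul_sum, Finset.sum_eq_zero,
          neg_zero]
        intro l hl
        rw [Finset.mem_range] at hl
        rw [Matrix.smul_mul, Matrix.vecMul_smul, ih (l + r) (by omega), smul_zero]
  · intro i hi
    have := he i (by omega)
    simp only [e] at this
    rwa [if_neg (by omega), if_pos (by omega), Int.toNat_natCast] at this

/-! ### Full row rank and the left kernel -/

theorem Matrix.eq_zero_of_vecMul_eq_zero_of_rank_eq {K m n : Type*} [Field K] [Fintype m] [Fintype n]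
    {M : Matrix m n K} (h : M.rank = Fintype.card m) {w : m → K} (hw : w ᵥ* M = 0) : w = 0 := by
  classical
  have htop : LinearMap.range M.mulVecLin = ⊤ :=
    Submodule.eq_top_of_finrank_eq (by rw [Module.finrank_fintype_fun_eq_card]; exact h)
  refine dotProduct_eq_zero _ fun u => ?_
  obtain ⟨g, rfl⟩ := LinearMap.range_eq_top.1 htop u
  rw [Matrix.mulVecLin_apply, dotProduct_mulVec, hw, zero_dotProduct]

theorem Matrix.exists_mulVec_eq_of_forall_vecMul_eq_zero {K m n : Type*} [Field K] [Fintype m] [Fintype n]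
    {M : Matrix m n K} (h : ∀ w : m → K, w ᵥ* M = 0 → w = 0) (b : m → K) : ∃ g, M *ᵥ g = b := by
  have hinj : Function.Injective M.vecMul := by
    intro x y hxy
    rw [← sub_eq_zero]
    exact h _ (by rw [Matrix.sub_vecMul, sub_eq_zero]; exact hxy)
  have hr := (Matrix.vecMul_injective_iff.1 hinj).rank_matrix
  have htop : LinearMap.range M.mulVecLin = ⊤ :=
    Submodule.eq_top_of_finrank_eq (by rw [Module.finrank_fintype_fun_eq_card]; exact hr)
  exact LinearMap.range_eq_top.1 htop b

/-! ### Consequences of the quasi-Weierstraß form -/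

namespace QuasiWeierstrassForm

variable {nx nJ nN nv : ℕ} {E A : Matrix (Fin nx) (Fin nx) ℝ}

/-- The dynamic block `B_J` of `S B`. -/
def dynInput (W : QuasiWeierstrassForm E A nJ nN) (B : Matrix (Fin nx) (Fin nv) ℝ) :
    Matrix (Fin nJ) (Fin nv) ℝ :=
  (W.S * B).toRows₁

/-- Padding `ξ` by zero on the algebraic block and pulling back by `S` gives a row vector
annihilating both `c E - A` and `B`; the block `c N - 1` meets only the zero padding. -/
theorem eq_zero_of_hautus (W : QuasiWeierstrassForm E A nJ nN) (B : Matrix (Fin nx) (Fin nv) ℝ) {c : ℂ}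
    (hc : (fromCols (pencil E A c) (B.map Complex.ofReal)).rank = nx) {ξ : Fin nJ → ℂ}
    (hJ : ξ ᵥ* W.J.map Complex.ofReal = c • ξ)
    (hB : ξ ᵥ* (W.dynInput B).map Complex.ofReal = 0) : ξ = 0 := by
  let f := Complex.ofRealHom
  let w : Fin nx → ℂ := Sum.elim ξ 0 ᵥ* W.S.map f
  have hpen : W.S.map f * pencil E A c * W.P.map f =
      fromBlocks (c • 1 - W.J.map f) 0 0 (c • W.N.map f - 1) := by
    have h1 : W.S.map f * E.map f * W.P.map f = fromBlocks 1 0 0 (W.N.map f) := by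
      rw [← Matrix.map_mul, ← Matrix.map_mul, W.transform_E, Matrix.fromBlocks_map]
      simp
    have h2 : W.S.map f * A.map f * W.P.map f = fromBlocks (W.J.map f) 0 0 1 := by
      rw [← Matrix.map_mul, ← Matrix.map_mul, W.transform_A, Matrix.fromBlocks_map]
      simp
    have h3 : pencil E A c = c • E.map f - A.map f := rfl
    rw [h3, Matrix.mul_sub, Matrix.sub_mul, Matrix.mul_smul, Matrix.smul_mul, h1, h2,
      Matrix.fromBlocks_smul, sub_eq_add_neg, Matrix.fromBlocks_neg, Matrix.fromBlocks_add]
    simp [sub_eq_add_neg]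
  have hP : W.P.map f * W.Pinv.map f = 1 := by
    rw [← Matrix.map_mul, W.P_mul_Pinv]; simp
  have hS : W.S.map f * W.Sinv.map f = 1 := by
    rw [← Matrix.map_mul, W.S_mul_Sinv]; simp
  have hw1 : w ᵥ* pencil E A c = 0 := by
    have : w ᵥ* pencil E A c ᵥ* W.P.map f = 0 := by
      rw [Matrix.vecMul_vecMul, Matrix.vecMul_vecMul, ← Matrix.mul_assoc, hpen,
        Matrix.vecMul_fromBlocks]
      have hJ' : ξ ᵥ* W.J.map f = c • ξ := hJ
      rw [Sum.elim_comp_inl, Sum.elim_comp_inr, Matrix.vecMul_sub, Matrix.vecMul_smul, Matrix.vecMul_one, hJ',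
        Matrix.zero_vecMul, Matrix.zero_vecMul, Matrix.vecMul_zero, sub_self, add_zero, add_zero]
      ext i; cases i <;> rfl
    calc w ᵥ* pencil E A c = w ᵥ* pencil E A c ᵥ* W.P.map f ᵥ* W.Pinv.map f := by
          rw [Matrix.vecMul_vecMul _ _ (W.Pinv.map f), hP, Matrix.vecMul_one]
      _ = 0 := by rw [this, Matrix.zero_vecMul]
  have hw2 : w ᵥ* B.map f = 0 := by
    have h1 : W.S.map f * B.map f =
        fromRows ((W.dynInput B).map f) ((W.algInput B).map f) := by
      rw [← Matrix.map_mul]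
      ext i j; cases i <;> rfl
    have hB' : ξ ᵥ* (W.dynInput B).map f = 0 := hB
    rw [Matrix.vecMul_vecMul, h1, Matrix.vecMul_fromRows]
    rw [Sum.elim_comp_inl, Sum.elim_comp_inr, hB', Matrix.zero_vecMul, add_zero]
  have hw : w = 0 := by
    refine Matrix.eq_zero_of_vecMul_eq_zero_of_rank_eq
      (M := fromCols (pencil E A c) (B.map Complex.ofReal)) (by rw [hc, Fintype.card_fin]) ?_
    rw [Matrix.vecMul_fromCols, hw1]
    have : w ᵥ* B.map Complex.ofReal = 0 := hw2
    rw [this]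
    ext i; cases i <;> rfl
  have h0 : Sum.elim ξ (0 : Fin nN → ℂ) = 0 := by
    calc _ = w ᵥ* W.Sinv.map f := by rw [Matrix.vecMul_vecMul, hS, Matrix.vecMul_one]
      _ = 0 := by rw [hw, Matrix.zero_vecMul]
  ext i
  exact congrFun h0 (Sum.inl i)

/-- The value `0` would force `B_N = 0`, a case where the index is `1` by convention. Positivity
leaves room for the feedthrough `D` in the term `i = 0` of the output, and makes the subtraction in
`L + nJ + δ - 1` exact. -/
theorem structuredIndex_pos (W : QuasiWeierstrassForm E A nJ nN) (B : Matrix (Fin nx) (Fin nv) ℝ) :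
    0 < W.structuredIndex B := by
  unfold structuredIndex
  split_ifs with h
  · obtain ⟨k, hk⟩ := W.isNilpotent_N
    refine Nat.pos_of_ne_zero fun h0 => h.2 ?_
    have hmem := Nat.sInf_mem (s := {i : ℕ | W.N ^ i * W.algInput B = 0}) ⟨k, by simp [hk]⟩
    rw [h0] at hmem
    simpa using hmem
  · exact one_pos

theorem pow_structuredIndex_mul (W : QuasiWeierstrassForm E A nJ nN)
    (B : Matrix (Fin nx) (Fin nv) ℝ) : W.N ^ W.structuredIndex B * W.algInput B = 0 := by
  unfold structuredIndex
  split_ifs with h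
  · obtain ⟨k, hk⟩ := W.isNilpotent_N
    exact Nat.sInf_mem (s := {i : ℕ | W.N ^ i * W.algInput B = 0}) ⟨k, by simp [hk]⟩
  · rw [not_and_or, not_not, not_lt, Nat.le_zero] at h
    rcases h with h | h
    · subst h
      ext i; exact i.elim0
    · rw [h, Matrix.mul_zero]

/-- The algebraic part of the state is determined by the next inputs. -/
theorem algebraic_state_eq (W : QuasiWeierstrassForm E A nJ nN) (B : Matrix (Fin nx) (Fin nv) ℝ)
    {w : ℕ → Fin nN → ℝ} {v : ℕ → Fin nv → ℝ}
    (hw : ∀ k, W.N *ᵥ w (k + 1) = w k + W.algInput B *ᵥ v k) (k : ℕ) :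
    w k = -∑ i ∈ Finset.range (W.structuredIndex B), (W.N ^ i * W.algInput B) *ᵥ v (k + i) := by
  set δ := W.structuredIndex B
  have hiter : ∀ m, w k = (W.N ^ m) *ᵥ w (k + m) -
      ∑ i ∈ Finset.range m, (W.N ^ i * W.algInput B) *ᵥ v (k + i) := by
    intro m
    induction m with
    | zero => simp
    | succ m ih =>
      have h1 : w (k + m) = W.N *ᵥ w (k + (m + 1)) - W.algInput B *ᵥ v (k + m) := by
        rw [← add_assoc, hw, add_sub_cancel_right]
      rw [Finset.sum_range_succ, ih, h1, Matrix.mulVec_sub, Matrix.mulVec_mulVec,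
        Matrix.mulVec_mulVec, ← pow_succ]
      abel
  obtain ⟨r, hr⟩ := W.isNilpotent_N
  -- After `δ + r` steps, `N ^ r = 0` removes the remote state, and `N ^ δ * B_N = 0` removes the
  -- inputs from `k + δ` on.
  have h1 := hiter (δ + r)
  rw [pow_add, hr, Matrix.mul_zero, Matrix.zero_mulVec, zero_sub, Finset.sum_range_add] at h1
  rw [h1, neg_inj, add_eq_left]
  refine Finset.sum_eq_zero fun i _ => ?_
  rw [add_comm δ i, pow_add, Matrix.mul_assoc, W.pow_structuredIndex_mul, Matrix.mul_zero,
    Matrix.zero_mulVec]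

end QuasiWeierstrassForm

namespace DescriptorSystem

variable {nx nv ny nJ nN : ℕ}

/-- In quasi-Weierstraß coordinates, the output is a function of the dynamic part of the state and of the
next `δ` inputs. -/
theorem exists_output_eq (S : DescriptorSystem nx nv ny) (W : QuasiWeierstrassForm S.E S.A nJ nN) :
    ∃ (C : Matrix (Fin ny) (Fin nJ) ℝ) (M : ℕ → Matrix (Fin ny) (Fin nv) ℝ),
      ∀ (v : ℕ → Vec nv) (y : ℕ → Vec ny), S.IsRealizationTrajectory v y →
        ∃ z : ℕ → Fin nJ → ℝ, (∀ k, z (k + 1) = W.J *ᵥ z k + W.dynInput S.B *ᵥ (v k).ofLp) ∧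
          ∀ k, (y k).ofLp = C *ᵥ z k +
            ∑ i ∈ Finset.range (W.structuredIndex S.B), M i *ᵥ (v (k + i)).ofLp := by
  let CP := S.C * W.P
  -- These matrices depend on the system alone, so one formula serves both the data and the
  -- trajectory to be represented.
  refine ⟨CP.toCols₁, fun i => -(CP.toCols₂ * (W.N ^ i * W.algInput S.B)) + if i = 0 then S.D else 0, ?_⟩
  rintro v y ⟨x, hx⟩
  let u : ℕ → Fin nJ ⊕ Fin nN → ℝ := fun k => W.Pinv *ᵥ (x k).ofLp
  have hxu : ∀ k, (x k).ofLp = W.P *ᵥ u k := fun k => by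
    rw [Matrix.mulVec_mulVec, W.P_mul_Pinv, Matrix.one_mulVec]
  have hSB : W.S * S.B = fromRows (W.dynInput S.B) (W.algInput S.B) :=
    (Matrix.fromRows_toRows _).symm
  have hu : ∀ k, fromBlocks 1 0 0 W.N *ᵥ u (k + 1) =
      fromBlocks W.J 0 0 1 *ᵥ u k + fromRows (W.dynInput S.B) (W.algInput S.B) *ᵥ (v k).ofLp := by
    intro k
    have h1 := congrArg (W.S *ᵥ ·) (hx k).1
    simp only [hxu, Matrix.mulVec_add, Matrix.mulVec_mulVec] at h1
    rwa [← Matrix.mul_assoc, ← Matrix.mul_assoc, W.transform_E, W.transform_A, hSB] at h1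
  have hz : ∀ k, u (k + 1) ∘ Sum.inl = W.J *ᵥ (u k ∘ Sum.inl) + W.dynInput S.B *ᵥ (v k).ofLp := by
    intro k
    have h1 := hu k
    rw [Matrix.fromBlocks_mulVec, Matrix.fromBlocks_mulVec, Matrix.fromRows_mulVec] at h1
    ext i
    simpa using congrFun h1 (Sum.inl i)
  have hw : ∀ k, W.N *ᵥ (u (k + 1) ∘ Sum.inr) = (u k ∘ Sum.inr) + W.algInput S.B *ᵥ (v k).ofLp := by
    intro k
    have h1 := hu k
    rw [Matrix.fromBlocks_mulVec, Matrix.fromBlocks_mulVec, Matrix.fromRows_mulVec] at h1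
    ext i
    simpa using congrFun h1 (Sum.inr i)
  refine ⟨fun k => u k ∘ Sum.inl, hz, fun k => ?_⟩
  have hD : ∑ i ∈ Finset.range (W.structuredIndex S.B), (if i = 0 then S.D else 0) *ᵥ (v (k + i)).ofLp =
      S.D *ᵥ (v k).ofLp := by
    rw [Finset.sum_eq_single 0]
    · simp
    · intro i _ hi; simp [hi]
    · intro h0; exact absurd (Finset.mem_range.2 (W.structuredIndex_pos S.B)) h0
  have hy : CP *ᵥ u k = CP.toCols₁ *ᵥ (u k ∘ Sum.inl) + CP.toCols₂ *ᵥ (u k ∘ Sum.inr) := by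
    conv_lhs => rw [← Matrix.fromCols_toCols CP, Matrix.fromCols_mulVec]
  simp only [Matrix.add_mulVec, Finset.sum_add_distrib, hD]
  rw [(hx k).2, hxu, Matrix.mulVec_mulVec, ← add_assoc]
  change CP *ᵥ u k + _ = _
  have hN := W.algebraic_state_eq S.B (w := fun k => u k ∘ Sum.inr) (v := fun k => (v k).ofLp) hw k
  rw [hy, hN, Matrix.mulVec_neg, Matrix.mulVec_sum]
  simp only [Matrix.mulVec_mulVec, Matrix.neg_mulVec, Finset.sum_neg_distrib]

end DescriptorSystem

/-! ### Willems' lemma in primal form -/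

theorem IsPersistentlyExciting.eq_zero {n T K : ℕ} {f : ℕ → Vec n} (h : IsPersistentlyExciting T K f)
    {θ : ℕ → Fin n → ℝ}
    (hθ : ∀ j < T + 1 - K, ∑ t ∈ Finset.range K, θ t ⬝ᵥ (f (j + t)).ofLp = 0) :
    ∀ t < K, θ t = 0 := by
  have h0 : (fun p : Fin K × Fin n => θ p.1 p.2) = 0 := by
    refine Matrix.eq_zero_of_vecMul_eq_zero_of_rank_eq (M := hankel K (T + 1 - K) f)
      (by simpa [IsPersistentlyExciting] using h) ?_
    ext j
    rw [Pi.zero_apply, ← hθ j j.2, Finset.sum_range]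
    simp only [Matrix.vecMul, dotProduct, Fintype.sum_prod_type, hankel, Matrix.of_apply, add_comm (j : ℕ)]
  intro t ht
  ext i
  exact congrFun h0 (⟨t, ht⟩, i)

/-- Willems' lemma for a controllable state equation: every state and every `m` inputs are a combination of those in
persistently exciting data. -/
theorem exists_combination_of_persistentlyExciting {n nv : ℕ} {J : Matrix (Fin n) (Fin n) ℝ}
    {B : Matrix (Fin n) (Fin nv) ℝ}
    (hctrl : ∀ ξ : Fin n → ℝ, (∀ k, ξ ᵥ* (J ^ k * B) = 0) → ξ = 0)
    {z : ℕ → Fin n → ℝ} {v : ℕ → Vec nv} (hz : ∀ k, z (k + 1) = J *ᵥ z k + B *ᵥ (v k).ofLp)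
    {T m : ℕ} (hpe : IsPersistentlyExciting T (m + n) v) (z₀ : Fin n → ℝ) (u : ℕ → Vec nv) :
    ∃ g : Fin (T + 1 - m) → ℝ, z₀ = ∑ j, g j • z j ∧ ∀ i < m, u i = ∑ j, g j • v (i + j) := by
  -- A left null vector of the stacked state and input data is a functional annihilating all
  -- windows, hence zero; so the columns span all pairs of a state and `m` inputs.
  obtain ⟨g, hg⟩ := Matrix.exists_mulVec_eq_of_forall_vecMul_eq_zero
    (M := fromRows (Matrix.of fun (i : Fin n) (j : Fin (T + 1 - m)) => z j i) (hankel m (T + 1 - m) v))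
    (fun w hw => by
      let η : ℕ → Fin nv → ℝ := fun i a => if hi : i < m then w (Sum.inr (⟨i, hi⟩, a)) else 0
      have hη : ∀ (i : Fin m) a, η i a = w (Sum.inr (i, a)) := fun i a => dif_pos i.2
      obtain ⟨h1, h2⟩ := eq_zero_of_annihilates_data hctrl hz (fun _ => hpe.eq_zero) (w ∘ Sum.inl) η
        (fun j hj => by
          refine Eq.trans ?_ (congrFun hw ⟨j, hj⟩)
          rw [Finset.sum_range]
          simp only [Matrix.vecMul, dotProduct, Fintype.sum_sum_type, Fintype.sum_prod_type, hη,
            Function.comp_apply, fromRows_apply_inl, fromRows_apply_inr, hankel, Matrix.of_apply,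
            add_comm j])
      ext i
      rcases i with i | ⟨i, a⟩
      · exact congrFun h1 i
      · rw [← hη, h2 i i.2]; rfl)
    (Sum.elim z₀ fun p => u p.1 p.2)
  refine ⟨g, ?_, fun i hi => ?_⟩
  · ext a
    have := congrFun hg (Sum.inl a)
    simp only [Matrix.mulVec, dotProduct, fromRows_apply_inl, Matrix.of_apply, Sum.elim_inl] at this
    simp only [← this, Finset.sum_apply, Pi.smul_apply, smul_eq_mul, mul_comm]
  · ext a
    have := congrFun hg (Sum.inr (⟨i, hi⟩, a))
    simp only [Matrix.mulVec, dotProduct, fromRows_apply_inr, hankel, Matrix.of_apply, Sum.elim_inr] at this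
    simp [← this, mul_comm]

/-! ### Shift combinations and the deterministic fundamental lemma -/

/-- The combination `g ↦ ∑ j, g_j f_{k + j}` of shifts of the sequence `f`. -/
noncomputable def shiftCombination {n : ℕ} (q : ℕ) (f : ℕ → Vec n) (k : ℕ) : Vec q →L[ℝ] Vec n :=
  ∑ j : Fin q, (EuclideanSpace.proj j : Vec q →L[ℝ] ℝ).smulRight (f (k + j))

theorem shiftCombination_apply {n q : ℕ} (f : ℕ → Vec n) (k : ℕ) (g : Vec q) :
    shiftCombination q f k g = ∑ j, g j • f (k + j) := by
  simp [shiftCombination]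

theorem stack_eq_hankel_mulVec_iff {L q n m : ℕ} {f : Fin L → Vec n} {h : Fin L → Vec m} {v : ℕ → Vec n}
    {y : ℕ → Vec m} {g : Vec q} :
    stack f h = fromRows (hankel L q v) (hankel L q y) *ᵥ g.ofLp ↔
      ∀ k : Fin L, f k = shiftCombination q v k g ∧ h k = shiftCombination q y k g := by
  simp only [shiftCombination_apply]
  constructor
  · intro hs k
    constructor
    · ext a
      have := congrFun hs (Sum.inl (k, a))
      simpa [stack, Matrix.mulVec, dotProduct, hankel, mul_comm] using this
    · ext a
      have := congrFun hs (Sum.inr (k, a))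
      simpa [stack, Matrix.mulVec, dotProduct, hankel, mul_comm] using this
  · intro hs
    ext i
    rcases i with ⟨k, a⟩ | ⟨k, a⟩
    · simp [stack, (hs k).1, Matrix.mulVec, dotProduct, hankel, mul_comm]
    · simp [stack, (hs k).2, Matrix.mulVec, dotProduct, hankel, mul_comm]

namespace DescriptorSystem

variable {nx nv ny : ℕ}

/-- The system is linear and time-invariant. -/
theorem satisfies_shiftCombination {S : DescriptorSystem nx nv ny} {x : ℕ → Vec nx} {v : ℕ → Vec nv}
    {y : ℕ → Vec ny} (h : ∀ k, S.Satisfies (x k) (x (k + 1)) (v k) (y k)) {q : ℕ} (g : Vec q) (k : ℕ) :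
    S.Satisfies (shiftCombination q x k g) (shiftCombination q x (k + 1) g)
      (shiftCombination q v k g) (shiftCombination q y k g) := by
  simp only [Satisfies, shiftCombination_apply, WithLp.ofLp_sum, WithLp.ofLp_smul, Matrix.mulVec_sum,
    Matrix.mulVec_smul, ← Finset.sum_add_distrib, ← smul_add]
  constructor
  · refine Finset.sum_congr rfl fun j _ => ?_
    rw [← (h _).1, add_right_comm]
  · exact Finset.sum_congr rfl fun j _ => by rw [← (h _).2]

/-- The deterministic fundamental lemma for descriptor systems. -/
theorem IsRealizationTrajectory.exists_shiftCombination {S : DescriptorSystem nx nv ny}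
    (hctrl : S.IsRControllable) {nJ δ : ℕ} (hind : S.HasIndices nJ δ) {T L : ℕ} {v : ℕ → Vec nv}
    {y : ℕ → Vec ny} (hvy : S.IsRealizationTrajectory v y)
    (hpe : IsPersistentlyExciting T (L + nJ + δ - 1) v) {v' : ℕ → Vec nv} {y' : ℕ → Vec ny}
    (h' : S.IsRealizationTrajectory v' y') :
    ∃ g : Vec (T + 2 - (L + δ)), ∀ k < L,
      v' k = shiftCombination _ v k g ∧ y' k = shiftCombination _ y k g := by
  obtain ⟨nN, W, rfl⟩ := hind
  obtain ⟨C, M, hCM⟩ := S.exists_output_eq W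
  obtain ⟨z, hz, hy⟩ := hCM v y hvy
  obtain ⟨z', hz', hy'⟩ := hCM v' y' h'
  have hδ := W.structuredIndex_pos S.B
  set δ := W.structuredIndex S.B
  -- The last output, at time `L - 1`, involves inputs up to time `L + δ - 2`; thus `m = L + δ - 1`
  -- inputs have to be matched.
  obtain ⟨m, hm⟩ : ∃ m, L + δ = m + 1 := ⟨L + δ - 1, by omega⟩
  rw [show L + nJ + δ - 1 = m + nJ by omega] at hpe
  obtain ⟨g, hg, hgv⟩ := exists_combination_of_persistentlyExciting
    (fun ξ => eq_zero_of_vecMul_pow_mul_eq_zero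
      (fun c _ => W.eq_zero_of_hautus S.B (hctrl c))) hz hpe (z' 0) v'
  rw [show T + 2 - (L + δ) = T + 1 - m by omega]
  refine ⟨WithLp.toLp 2 g, ?_⟩
  simp only [shiftCombination_apply]
  -- Equal initial states and equal inputs propagate to equal dynamic states.
  have hstate : ∀ k < L, z' k = ∑ j, g j • z (k + j) := by
    intro k
    induction k with
    | zero => intro _; simpa using hg
    | succ k ih =>
      intro hk
      rw [hz', ih (by omega), hgv k (by omega), WithLp.ofLp_sum, Matrix.mulVec_sum, Matrix.mulVec_sum,
        ← Finset.sum_add_distrib]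
      refine Finset.sum_congr rfl fun j _ => ?_
      rw [WithLp.ofLp_smul, Matrix.mulVec_smul, Matrix.mulVec_smul, ← smul_add, ← hz, add_right_comm]
  intro k hk
  refine ⟨hgv k (by omega), WithLp.ofLp_injective 2 ?_⟩
  have hsum : ∑ i ∈ Finset.range δ, M i *ᵥ (v' (k + i)).ofLp =
      ∑ i ∈ Finset.range δ, ∑ j, g j • M i *ᵥ (v (k + j + i)).ofLp := by
    refine Finset.sum_congr rfl fun i hi => ?_
    rw [Finset.mem_range] at hi
    rw [hgv (k + i) (by omega), WithLp.ofLp_sum, Matrix.mulVec_sum]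
    refine Finset.sum_congr rfl fun j _ => ?_
    rw [WithLp.ofLp_smul, Matrix.mulVec_smul, add_right_comm]
  rw [hy', hstate k hk, hsum, Finset.sum_comm, Matrix.mulVec_sum, ← Finset.sum_add_distrib, WithLp.ofLp_sum]
  refine Finset.sum_congr rfl fun j _ => ?_
  rw [Matrix.mulVec_smul, ← Finset.smul_sum, ← smul_add, WithLp.ofLp_smul, hy]

end DescriptorSystem

/-! ### Linear choice of coefficients, lifted to `ℓ^p` and `L^p` -/

/-- A linear section of `f` over its range extends to the whole codomain. Choosing preimages
linearly is what later preserves measurability and integrability. -/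
theorem LinearMap.exists_generalized_inverse {K V W : Type*} [Field K] [AddCommGroup V] [Module K V]
    [AddCommGroup W] [Module K W] (f : V →ₗ[K] W) : ∃ r : W →ₗ[K] V, ∀ x, f (r (f x)) = f x := by
  obtain ⟨s, hs⟩ := f.rangeRestrict.exists_rightInverse_of_surjective f.range_rangeRestrict
  obtain ⟨r, hr⟩ := s.exists_extend
  refine ⟨r, fun x => ?_⟩
  have h1 : r (f x) = s (f.rangeRestrict x) := LinearMap.congr_fun hr (f.rangeRestrict x)
  rw [h1]
  exact congrArg Subtype.val (LinearMap.congr_fun hs (f.rangeRestrict x))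

theorem pi_norm_le_sum_norm {κ E : Type*} [Fintype κ] [SeminormedAddCommGroup E] (w : κ → E) :
    ‖w‖ ≤ ∑ k, ‖w k‖ :=
  (pi_norm_le_iff_of_nonneg (Finset.sum_nonneg fun _ _ => norm_nonneg _)).2 fun k =>
    Finset.single_le_sum (f := fun k => ‖w k‖) (fun _ _ => norm_nonneg _) (Finset.mem_univ k)

theorem MeasureTheory.AEStronglyMeasurable.fintype_pi {Ω κ E : Type*} [MeasurableSpace Ω] {μ : Measure Ω}
    [Fintype κ] [TopologicalSpace E] [AddCommMonoid E] [ContinuousAdd E] {f : κ → Ω → E}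
    (h : ∀ k, AEStronglyMeasurable (f k) μ) : AEStronglyMeasurable (fun ω k => f k ω) μ := by
  classical
  -- As a finite sum of continuous coordinate injections, the tuple needs no countability assumption
  -- on `E`.
  have h1 : (fun ω k => f k ω) = fun ω => ∑ k, Pi.single k (f k ω) := by
    ext ω : 1
    exact (Finset.univ_sum_single fun k => f k ω).symm
  rw [h1]
  exact Finset.aestronglyMeasurable_fun_sum _ fun k _ =>
    (continuous_single k).comp_aestronglyMeasurable (h k)

section Lift

variable {E F G : Type*} [NormedAddCommGroup E] [NormedSpace ℝ E] [NormedAddCommGroup F]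
  [NormedSpace ℝ F] [NormedAddCommGroup G] [NormedSpace ℝ G] {L : ℕ}

/-- Dominating by sums of norms reduces membership in `ℓ^p` or `L^p` to closure under finite sums
and scalars. -/
theorem ContinuousLinearMap.norm_apply_pi_prod_le (R : ((Fin L → E) × (Fin L → F)) →L[ℝ] G)
    (v : Fin L → E) (y : Fin L → F) : ‖R (v, y)‖ ≤ ‖R‖ * (∑ k, ‖v k‖ + ∑ k, ‖y k‖) := by
  refine (R.le_opNorm _).trans ?_
  gcongr
  rw [Prod.norm_def]
  exact max_le ((pi_norm_le_sum_norm v).trans (le_add_of_nonneg_right (by positivity)))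
    ((pi_norm_le_sum_norm y).trans (le_add_of_nonneg_left (by positivity)))

theorem lp.exists_eq_clm_pi_prod {ι : Type*} {p : ℝ≥0∞} (R : ((Fin L → E) × (Fin L → F)) →L[ℝ] G)
    (v : Fin L → lp (fun _ : ι => E) p) (y : Fin L → lp (fun _ : ι => F) p) :
    ∃ g : lp (fun _ : ι => G) p, ∀ i, g i = R (fun k => v k i, fun k => y k i) := by
  refine ⟨⟨fun i => R (fun k => v k i, fun k => y k i), ?_⟩, fun _ => rfl⟩
  refine Memℓp.mono (g := fun i => ‖R‖ * (∑ k, ‖v k i‖ + ∑ k, ‖y k i‖)) ?_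
    fun i => R.norm_apply_pi_prod_le _ _
  refine Memℓp.const_mul (Memℓp.add ?_ ?_) _
  · exact Memℓp.finsetSum _ fun k _ => (lp.memℓp (v k)).norm
  · exact Memℓp.finsetSum _ fun k _ => (lp.memℓp (y k)).norm

theorem lp.exists_eq_clm {ι : Type*} {p : ℝ≥0∞} (R : E →L[ℝ] G) (v : lp (fun _ : ι => E) p) :
    ∃ g : lp (fun _ : ι => G) p, ∀ i, g i = R (v i) :=
  ⟨⟨fun i => R (v i), Memℓp.mono (g := fun i => ‖R‖ * ‖v i‖) ((lp.memℓp v).norm.const_mul _)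
    fun _ => R.le_opNorm _⟩, fun _ => rfl⟩

theorem MeasureTheory.Lp.exists_ae_eq_clm_pi_prod {Ω : Type*} [MeasurableSpace Ω] {μ : Measure Ω}
    {p : ℝ≥0∞} (R : ((Fin L → E) × (Fin L → F)) →L[ℝ] G) (V : Fin L → Lp E p μ) (Y : Fin L → Lp F p μ) :
    ∃ g : Lp G p μ, ∀ᵐ ω ∂μ, g ω = R (fun k => V k ω, fun k => Y k ω) := by
  have hmem : MemLp (fun ω => R (fun k => V k ω, fun k => Y k ω)) p μ := by
    refine MemLp.of_le (g := fun ω => ‖R‖ * (∑ k, ‖V k ω‖ + ∑ k, ‖Y k ω‖)) ?_ ?_ ?_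
    · exact MemLp.const_mul ((memLp_finsetSum _ fun k _ => (Lp.memLp (V k)).norm).add
        (memLp_finsetSum _ fun k _ => (Lp.memLp (Y k)).norm)) _
    · refine R.continuous.comp_aestronglyMeasurable (AEStronglyMeasurable.prodMk ?_ ?_)
      · exact AEStronglyMeasurable.fintype_pi fun k => Lp.aestronglyMeasurable (V k)
      · exact AEStronglyMeasurable.fintype_pi fun k => Lp.aestronglyMeasurable (Y k)
    · exact Filter.Eventually.of_forall fun ω =>
        (R.norm_apply_pi_prod_le _ _).trans (Real.le_norm_self _)
  exact ⟨hmem.toLp _, hmem.coeFn_toLp⟩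

end Lift

/-- A continuous linear map which recovers, from a pair of sequences in the column span of the
data matrix, coefficients that generate it. -/
theorem exists_clm_generating {nv ny : ℕ} (L q : ℕ) (v : ℕ → Vec nv) (y : ℕ → Vec ny) :
    ∃ R : ((Fin L → Vec nv) × (Fin L → Vec ny)) →L[ℝ] Vec q, ∀ f h,
      (∃ g : Vec q, ∀ k : Fin L, f k = shiftCombination q v k g ∧ h k = shiftCombination q y k g) →
        ∀ k : Fin L, f k = shiftCombination q v k (R (f, h)) ∧ h k = shiftCombination q y k (R (f, h)) := by
  let Φ : Vec q →ₗ[ℝ] (Fin L → Vec nv) × (Fin L → Vec ny) :=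
    (LinearMap.pi fun k : Fin L => (shiftCombination q v k : Vec q →ₗ[ℝ] Vec nv)).prod
      (LinearMap.pi fun k : Fin L => (shiftCombination q y k : Vec q →ₗ[ℝ] Vec ny))
  obtain ⟨r, hr⟩ := Φ.exists_generalized_inverse
  refine ⟨LinearMap.toContinuousLinearMap r, ?_⟩
  rintro f h ⟨g, hg⟩ k
  have hΦ : Φ g = (f, h) :=
    Prod.ext (funext fun k => (hg k).1.symm) (funext fun k => (hg k).2.symm)
  have h1 := hr g
  rw [hΦ] at h1
  exact ⟨(congrFun (congrArg Prod.fst h1) k).symm, (congrFun (congrArg Prod.snd h1) k).symm⟩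

/-! ### The fundamental lemma for coefficients and for random variables -/

namespace DescriptorSystem

variable {nx nv ny : ℕ}

theorem isCoefficientTrajectory_iff {ι : Type*} {S : DescriptorSystem nx nv ny}
    (hctrl : S.IsRControllable) {nJ δ : ℕ} (hind : S.HasIndices nJ δ) {T L : ℕ} {v : ℕ → Vec nv}
    {y : ℕ → Vec ny} (hvy : S.IsRealizationTrajectory v y)
    (hpe : IsPersistentlyExciting T (L + nJ + δ - 1) v)
    (f : Fin L → ι → Vec nv) (h : Fin L → ι → Vec ny) :
    S.IsCoefficientTrajectory f h ↔
      ∃ g : lp (fun _ : ι => Vec (T + 2 - (L + δ))) 2, ∀ i : ι,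
        stack (fun k => f k i) (fun k => h k i) =
          fromRows (hankel L (T + 2 - (L + δ)) v) (hankel L (T + 2 - (L + δ)) y) *ᵥ (g i).ofLp := by
  simp only [stack_eq_hankel_mulVec_iff]
  constructor
  · rintro ⟨x', v', y', hS, hfh⟩
    obtain ⟨R, hR⟩ := exists_clm_generating L (T + 2 - (L + δ)) v y
    -- `R` is applied to `v'` and `y'`, which lie in `ℓ²`, because `f` and `h` are bare families.
    obtain ⟨g, hg⟩ := lp.exists_eq_clm_pi_prod R (fun k : Fin L => v' k) (fun k : Fin L => y' k)
    refine ⟨g, fun i => ?_⟩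
    have htraj : S.IsRealizationTrajectory (fun k => v' k i) (fun k => y' k i) :=
      ⟨fun k => x' k i, fun k => hS k i⟩
    obtain ⟨c, hc⟩ := hvy.exists_shiftCombination hctrl hind hpe htraj
    have h1 := hR (fun k => v' k i) (fun k => y' k i) ⟨c, fun k => hc k k.2⟩
    rw [← hg] at h1
    intro k
    rw [← (hfh k i).1, ← (hfh k i).2]
    exact h1 k
  · rintro ⟨g, hg⟩
    -- The data have states on all of `ℕ`, so combining their shifts with `g` also yields the
    -- continuation beyond `L - 1`.
    obtain ⟨x, hx⟩ := hvy
    choose x' hx' using fun k => lp.exists_eq_clm (shiftCombination (T + 2 - (L + δ)) x k) g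
    choose v' hv' using fun k => lp.exists_eq_clm (shiftCombination (T + 2 - (L + δ)) v k) g
    choose y' hy' using fun k => lp.exists_eq_clm (shiftCombination (T + 2 - (L + δ)) y k) g
    refine ⟨x', v', y', fun k i => ?_, fun k i => ?_⟩
    · rw [hx', hx', hv', hy']
      exact satisfies_shiftCombination hx (g i) k
    · rw [hv', hy']
      exact ⟨(hg i k).1.symm, (hg i k).2.symm⟩

theorem isRandomTrajectory_iff {Ω : Type*} [MeasurableSpace Ω] {μ : Measure Ω}
    {S : DescriptorSystem nx nv ny}
    (hctrl : S.IsRControllable) {nJ δ : ℕ} (hind : S.HasIndices nJ δ) {T L : ℕ} {v : ℕ → Vec nv}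
    {y : ℕ → Vec ny} (hvy : S.IsRealizationTrajectory v y)
    (hpe : IsPersistentlyExciting T (L + nJ + δ - 1) v)
    (V : Fin L → Lp (Vec nv) 2 μ) (Y : Fin L → Lp (Vec ny) 2 μ) :
    S.IsRandomTrajectory V Y ↔
      ∃ G : Lp (Vec (T + 2 - (L + δ))) 2 μ, ∀ᵐ ω ∂μ,
        stack (fun k => V k ω) (fun k => Y k ω) =
          fromRows (hankel L (T + 2 - (L + δ)) v) (hankel L (T + 2 - (L + δ)) y) *ᵥ (G ω).ofLp := by
  simp only [stack_eq_hankel_mulVec_iff]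
  constructor
  · rintro ⟨X', V', Y', hS, hVY⟩
    obtain ⟨R, hR⟩ := exists_clm_generating L (T + 2 - (L + δ)) v y
    obtain ⟨G, hG⟩ := Lp.exists_ae_eq_clm_pi_prod R V Y
    refine ⟨G, ?_⟩
    -- As there are countably many instants, one null set suffices for the whole path to be a
    -- realization trajectory.
    filter_upwards [hG, ae_all_iff.2 hS] with ω hGω hSω
    have htraj : S.IsRealizationTrajectory (fun k => V' k ω) (fun k => Y' k ω) :=
      ⟨fun k => X' k ω, hSω⟩
    obtain ⟨c, hc⟩ := hvy.exists_shiftCombination hctrl hind hpe htraj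
    rw [hGω]
    refine hR (fun k => V k ω) (fun k => Y k ω) ⟨c, fun k => ?_⟩
    rw [← (hVY k).1, ← (hVY k).2]
    exact hc k k.2
  · rintro ⟨G, hG⟩
    obtain ⟨x, hx⟩ := hvy
    refine ⟨fun k => (shiftCombination (T + 2 - (L + δ)) x k).compLp G,
      fun k => (shiftCombination (T + 2 - (L + δ)) v k).compLp G,
      fun k => (shiftCombination (T + 2 - (L + δ)) y k).compLp G, fun k => ?_, fun k => ⟨?_, ?_⟩⟩
    · filter_upwards [(shiftCombination (T + 2 - (L + δ)) x k).coeFn_compLp G,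
        (shiftCombination (T + 2 - (L + δ)) x (k + 1)).coeFn_compLp G,
        (shiftCombination (T + 2 - (L + δ)) v k).coeFn_compLp G,
        (shiftCombination (T + 2 - (L + δ)) y k).coeFn_compLp G] with ω h1 h2 h3 h4
      rw [h1, h2, h3, h4]
      exact satisfies_shiftCombination hx (G ω) k
    · refine Lp.ext ?_
      filter_upwards [hG, (shiftCombination (T + 2 - (L + δ)) v k).coeFn_compLp G] with ω h1 h2
      rw [h2, (h1 k).1]
    · refine Lp.ext ?_
      filter_upwards [hG, (shiftCombination (T + 2 - (L + δ)) y k).coeFn_compLp G] with ω h1 h2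
      rw [h2, (h1 k).2]

end DescriptorSystem

theorem mainTheorem1
    {Ω : Type*} [MeasurableSpace Ω] (μ : Measure Ω) [IsProbabilityMeasure μ]
    {ι : Type*} (φ : HilbertBasis ι ℝ (Lp ℝ 2 μ))
    {nx nv ny : ℕ} (S : DescriptorSystem nx nv ny)
    (hreg : S.IsRegular) (hctrl : S.IsRControllable)
    (nJ δ : ℕ) (hind : S.HasIndices nJ δ)
    (T L : ℕ) (v : ℕ → Vec nv) (y : ℕ → Vec ny)
    (hvy : S.IsRealizationTrajectory v y)
    (hpe : IsPersistentlyExciting T (L + nJ + δ - 1) v)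
    (V : Fin L → Lp (Vec nv) 2 μ) (Y : Fin L → Lp (Vec ny) 2 μ) :
    (S.IsCoefficientTrajectory (fun k => pceCoeff φ (V k)) (fun k => pceCoeff φ (Y k)) ↔
      ∃ g : lp (fun _ : ι => Vec (T + 2 - (L + δ))) 2, ∀ i : ι,
        stack (fun k => pceCoeff φ (V k) i) (fun k => pceCoeff φ (Y k) i) =
          fromRows (hankel L (T + 2 - (L + δ)) v) (hankel L (T + 2 - (L + δ)) y) *ᵥ
            (g i).ofLp) ∧
    (S.IsRandomTrajectory V Y ↔
      ∃ G : Lp (Vec (T + 2 - (L + δ))) 2 μ, ∀ᵐ ω ∂μ,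
        stack (fun k => V k ω) (fun k => Y k ω) =
          fromRows (hankel L (T + 2 - (L + δ)) v) (hankel L (T + 2 - (L + δ)) y) *ᵥ
            (G ω).ofLp) :=
  ⟨S.isCoefficientTrajectory_iff hctrl hind hvy hpe _ _, S.isRandomTrajectory_iff hctrl hind hvy hpe V Y⟩
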